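/- An odd-even partition of a nonnegative integer $n$ is a partition of $n$ whose parts, listed in weakly increasing order, alternate in parity, starting with the smallest part odd (the empty partition of $0$ counts as odd-even). Let $OE(n)$ be the number of odd-even partitions of $n$, so that $OE(0)=1$, and put \[ \mathscr O_e(q)=\sum_{n=0}^\infty OE(2n)q^{2n},\qquad \mathscr O_o(q)=\sum_{n=0}^\infty OE(2n+1)q^{2n+1}. \] Then both series converge at $q=e^{-\varepsilon}$ for every $\varepsilon>0$, and as $\varepsilon\to0^+$ \[ \mathscr O_e(e^{-\varepsilon})\sim\mathscr O_o(e^{-\varepsilon})\sim\frac{1}{\sqrt{2\sqrt5}}\,e^{\pi^2/(20\varepsilon)}. \] -/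

import Mathlib

open Filter Topology Asymptotics

/-- A partition is odd-even if, when its parts are listed in weakly increasing order, successive
parts have opposite parity and the first (smallest) part, if there is one, is odd.
The empty partition of `0` is odd-even. -/
def IsOddEvenPartition {n : ℕ} (p : n.Partition) : Prop :=
  (p.parts.sort (· ≤ ·)).IsChain (fun a b => a % 2 ≠ b % 2) ∧
    ∀ a ∈ (p.parts.sort (· ≤ ·)).head?, Odd a

instance decidablePredIsOddEvenPartition (n : ℕ) :
    DecidablePred (IsOddEvenPartition (n := n)) := fun _ =>
  inferInstanceAs (Decidable (_ ∧ _))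

/-- The number of odd-even partitions of `n`; in particular its value at `0` is `1`. -/
def oddEvenCount (n : ℕ) : ℕ :=
  (Finset.univ.filter (fun p : n.Partition => IsOddEvenPartition p)).card

/-- The even part of the generating function of the number of odd-even partitions. -/
noncomputable def oddEvenGenEven (q : ℝ) : ℝ :=
  ∑' n : ℕ, (oddEvenCount (2 * n) : ℝ) * q ^ (2 * n)

/-- The odd part of the generating function of the number of odd-even partitions. -/
noncomputable def oddEvenGenOdd (q : ℝ) : ℝ :=
  ∑' n : ℕ, (oddEvenCount (2 * n + 1) : ℝ) * q ^ (2 * n + 1)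

/-! Successive differences of an odd-even partition, counted from a fictitious part 0, are arbitrary
odd numbers. Hence the partitions with k parts have generating function q^(k(k+1)/2) / ∏_{j≤k} (1 -
q^(2j)), and the parity of their size is that of k(k+1)/2: even sizes come from k ≡ 0, 3 mod 4, odd
sizes from k ≡ 1, 2.

Put q = e^(-e) and t = e(k+1). The finite product is a quotient of two infinite ones. The full Euler
product is evaluated by inversion of the Dedekind eta function (`eulerProd_inversion`), which gives
√(e/π) e^(π²/(12e)). The tail is expanded by the dilogarithm, so the k-th term decays like
exp(-`rateFun` t / e), where `rateFun` t = t²/2 + Li₂(e^(-2t))/2.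

The critical equation e^(-t) = 1 - e^(-2t) puts the minimum at t₀ = log φ. There the rate is π²/30,
by the value of Li₂ at φ⁻² (`dilog_of_sq_eq_one_sub`), and its second derivative is √5. Since π²/12
- π²/30 = π²/20, the exponent of the theorem appears.

On the scale t - t₀ ~ √e the terms form a Gaussian profile exp(-√5 y²/2). Summing over one residue
class mod 4 is a Riemann sum of step 4√e in y (`tendsto_sqrt_mul_tsum_normTerm`), so all four
classes contribute equally, each half of the claimed constant. Even and odd sizes take two classes
each. -/

/-! ### Odd-even partitions and lists of gaps -/

/-- `b` exceeds `a` by an odd amount. -/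
def IsOddStep (a b : ℕ) : Prop := ∃ d, b = a + 1 + 2 * d

lemma isOddStep_iff (a b : ℕ) : IsOddStep a b ↔ a % 2 ≠ b % 2 ∧ a ≤ b := by
  constructor
  · rintro ⟨d, rfl⟩; omega
  · rintro ⟨h, h'⟩; exact ⟨(b - a - 1) / 2, by omega⟩

lemma isChain_isOddStep_iff {l : List ℕ} (hl : l.Pairwise (· ≤ ·)) :
    l.IsChain IsOddStep ↔ l.IsChain (fun a b => a % 2 ≠ b % 2) := by
  constructor
  · exact fun h => h.imp fun a b hab => ((isOddStep_iff a b).1 hab).1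
  · intro h
    have h2 := hl.isChain
    clear hl
    induction l with
    | nil => exact List.IsChain.nil
    | cons a l ih =>
      rw [List.isChain_cons] at h h2 ⊢
      exact ⟨fun y hy => (isOddStep_iff a y).2 ⟨h.1 y hy, h2.1 y hy⟩, ih h.2 h2.2⟩

/-- The list of parts whose successive differences, starting from `s`, are `1 + 2 * d` for `d`
in the given list of gaps. -/
def partsOfGaps : ℕ → List ℕ → List ℕ
  | _, [] => []
  | s, d :: l => (s + 1 + 2 * d) :: partsOfGaps (s + 1 + 2 * d) l

/-- The inverse of `partsOfGaps`. -/
def gapsOfParts : ℕ → List ℕ → List ℕ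
  | _, [] => []
  | s, b :: m => (b - s - 1) / 2 :: gapsOfParts b m

/-- The sum of the odd-even partition with a given list of gaps. -/
def gapWeight : List ℕ → ℕ
  | [] => 0
  | d :: l => (l.length + 1) * (1 + 2 * d) + gapWeight l

lemma gapsOfParts_partsOfGaps (s : ℕ) (l : List ℕ) : gapsOfParts s (partsOfGaps s l) = l := by
  induction l generalizing s with
  | nil => rfl
  | cons d l ih =>
    simp only [partsOfGaps, gapsOfParts, ih, List.cons.injEq, and_true]
    omega

lemma partsOfGaps_gapsOfParts {s : ℕ} {m : List ℕ} (h : (s :: m).IsChain IsOddStep) :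
    partsOfGaps s (gapsOfParts s m) = m := by
  induction m generalizing s with
  | nil => rfl
  | cons b m ih =>
    rw [List.isChain_cons_cons] at h
    obtain ⟨⟨d, hd⟩, h2⟩ := h
    have : s + 1 + 2 * ((b - s - 1) / 2) = b := by omega
    simp only [partsOfGaps, gapsOfParts, this, ih h2]

lemma isChain_partsOfGaps (s : ℕ) (l : List ℕ) :
    (s :: partsOfGaps s l).IsChain IsOddStep := by
  induction l generalizing s with
  | nil => exact List.IsChain.singleton _
  | cons d l ih =>
    rw [partsOfGaps, List.isChain_cons_cons]
    exact ⟨⟨d, rfl⟩, ih _⟩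

lemma sum_partsOfGaps (s : ℕ) (l : List ℕ) :
    (partsOfGaps s l).sum = s * l.length + gapWeight l := by
  induction l generalizing s with
  | nil => simp [partsOfGaps, gapWeight]
  | cons d l ih =>
    simp only [partsOfGaps, gapWeight, List.sum_cons, ih, List.length_cons]
    ring

lemma lt_of_mem_partsOfGaps {s b : ℕ} {l : List ℕ} (h : b ∈ partsOfGaps s l) : s < b := by
  induction l generalizing s with
  | nil => simp [partsOfGaps] at h
  | cons d l ih =>
    rw [partsOfGaps, List.mem_cons] at h
    rcases h with rfl | h
    · omega
    · have := ih h; omega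

lemma pairwise_le_partsOfGaps (s : ℕ) (l : List ℕ) :
    (partsOfGaps s l).Pairwise (· ≤ ·) := by
  induction l generalizing s with
  | nil => exact List.Pairwise.nil
  | cons d l ih =>
    rw [partsOfGaps, List.pairwise_cons]
    exact ⟨fun b hb => (lt_of_mem_partsOfGaps hb).le, ih _⟩

/-- A leading 0 turns the oddness of the smallest part into one more odd step, so that all gaps are
of the same kind. -/
lemma isOddEvenPartition_iff {n : ℕ} (p : n.Partition) :
    IsOddEvenPartition p ↔ (0 :: p.parts.sort (· ≤ ·)).IsChain IsOddStep := by
  rw [isChain_isOddStep_iff, List.isChain_cons, IsOddEvenPartition, and_comm]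
  · refine and_congr (forall₂_congr fun a _ => ?_) Iff.rfl
    rw [Nat.odd_iff]; omega
  · exact List.pairwise_cons.2 ⟨fun _ _ => Nat.zero_le _, Multiset.pairwise_sort _ _⟩

lemma sort_coe_partsOfGaps (s : ℕ) (l : List ℕ) :
    (partsOfGaps s l : Multiset ℕ).sort (· ≤ ·) = partsOfGaps s l :=
  List.Perm.eq_of_pairwise' (Multiset.pairwise_sort _ _) (pairwise_le_partsOfGaps s l)
    (Multiset.coe_eq_coe.1 (Multiset.sort_eq _ _))

/-- Odd-even partitions of `n` correspond to lists of gaps of weight `n`. -/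
def oddEvenPartitionEquiv (n : ℕ) :
    {p : n.Partition // IsOddEvenPartition p} ≃ {l : List ℕ // gapWeight l = n} where
  toFun p := ⟨gapsOfParts 0 (p.1.parts.sort (· ≤ ·)), by
    have h := sum_partsOfGaps 0 (gapsOfParts 0 (p.1.parts.sort (· ≤ ·)))
    rw [partsOfGaps_gapsOfParts ((isOddEvenPartition_iff p.1).1 p.2), zero_mul, zero_add] at h
    rw [← h, ← Multiset.sum_coe, Multiset.sort_eq, p.1.parts_sum]⟩
  invFun l := ⟨⟨partsOfGaps 0 l.1, fun {i} hi => lt_of_mem_partsOfGaps (s := 0) (by simpa using hi), by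
      rw [Multiset.sum_coe, sum_partsOfGaps, zero_mul, zero_add, l.2]⟩, by
    rw [isOddEvenPartition_iff]
    simp only [sort_coe_partsOfGaps]
    exact isChain_partsOfGaps 0 l.1⟩
  left_inv p := by
    apply Subtype.ext
    apply Nat.Partition.ext
    simp only [partsOfGaps_gapsOfParts ((isOddEvenPartition_iff p.1).1 p.2), Multiset.sort_eq]
  right_inv l := by
    apply Subtype.ext
    simp only [sort_coe_partsOfGaps, gapsOfParts_partsOfGaps]

instance fintypeGapWeight (n : ℕ) : Fintype {l : List ℕ // gapWeight l = n} :=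
  Fintype.ofEquiv _ (oddEvenPartitionEquiv n)

lemma card_gapWeight (n : ℕ) :
    Fintype.card {l : List ℕ // gapWeight l = n} = oddEvenCount n := by
  rw [← Fintype.card_congr (oddEvenPartitionEquiv n), Fintype.card_subtype, oddEvenCount]

/-! ### The generating function by number of parts -/

/-- The generating function of odd-even partitions with `k` parts. -/
noncomputable def oddEvenTerm (q : ℝ) (k : ℕ) : ℝ :=
  ∏ j ∈ Finset.range k, q ^ (j + 1) / (1 - q ^ (2 * (j + 1)))

lemma oddEvenTerm_pos {q : ℝ} (h0 : 0 < q) (h1 : q < 1) (k : ℕ) : 0 < oddEvenTerm q k := by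
  refine Finset.prod_pos fun j _ => div_pos (by positivity) ?_
  exact sub_pos.2 (pow_lt_one₀ h0.le h1 (by omega))

/-- Prepending an entry to a list. -/
def listLengthSuccEquiv (k : ℕ) :
    ℕ × {l : List ℕ // l.length = k} ≃ {l : List ℕ // l.length = k + 1} where
  toFun x := ⟨x.1 :: x.2.1, by simp [x.2.2]⟩
  invFun l := ⟨l.1.headI, ⟨l.1.tail, by simp [l.2]⟩⟩
  left_inv x := by simp
  right_inv l := by
    obtain ⟨l, hl⟩ := l
    cases l with
    | nil => simp at hl
    | cons a l => simp

/-- A gap d prepended to k gaps raises all k + 1 parts, hence contributes the factor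
q^((k+1)(1+2d)). Summing over d is a geometric series of ratio q^(2(k+1)). -/
lemma hasSum_gapWeight_length {q : ℝ} (h0 : 0 < q) (h1 : q < 1) (k : ℕ) :
    HasSum (fun l : {l : List ℕ // l.length = k} => q ^ gapWeight l.1) (oddEvenTerm q k) := by
  induction k with
  | zero =>
    have : Unique {l : List ℕ // l.length = 0} :=
      ⟨⟨⟨[], rfl⟩⟩, fun l => Subtype.ext (List.length_eq_zero_iff.1 l.2)⟩
    convert hasSum_unique (fun l : {l : List ℕ // l.length = 0} => q ^ gapWeight l.1) using 1
    have : (default : {l : List ℕ // l.length = 0}).1 = [] :=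
      List.length_eq_zero_iff.1 (default : {l : List ℕ // l.length = 0}).2
    simp [oddEvenTerm, this, gapWeight]
  | succ k ih =>
    have hq : q ^ (2 * (k + 1)) < 1 := pow_lt_one₀ h0.le h1 (by omega)
    have hg := (hasSum_geometric_of_lt_one (by positivity) hq).mul_left (q ^ (k + 1))
    rw [← div_eq_mul_inv] at hg
    have hs := hg.summable.mul_of_nonneg ih.summable (fun d => by positivity)
      (fun d => by positivity)
    rw [oddEvenTerm, Finset.prod_range_succ, mul_comm, ← (listLengthSuccEquiv k).hasSum_iff]
    refine Eq.mp (congrArg (HasSum · _) (funext ?_)) (hg.mul ih hs)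
    rintro ⟨d, l, hl⟩
    simp only [Function.comp_apply, listLengthSuccEquiv, Equiv.coe_fn_mk, gapWeight, hl]
    rw [← pow_mul, ← pow_add, ← pow_add]
    ring_nf

lemma summable_oddEvenTerm {q : ℝ} (h0 : 0 < q) (h1 : q < 1) : Summable (oddEvenTerm q) := by
  refine summable_of_ratio_test_tendsto_lt_one (l := 0) one_pos
    (Eventually.of_forall fun k => (oddEvenTerm_pos h0 h1 k).ne') ?_
  have h : ∀ k, ‖oddEvenTerm q (k + 1)‖ / ‖oddEvenTerm q k‖ =
      q ^ (k + 1) / (1 - q ^ (2 * (k + 1))) := by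
    intro k
    rw [Real.norm_of_nonneg (oddEvenTerm_pos h0 h1 _).le,
      Real.norm_of_nonneg (oddEvenTerm_pos h0 h1 _).le, oddEvenTerm, Finset.prod_range_succ,
      ← oddEvenTerm, mul_div_cancel_left₀ _ (oddEvenTerm_pos h0 h1 _).ne']
  simp only [h]
  have ht := (tendsto_pow_atTop_nhds_zero_of_lt_one h0.le h1).comp (tendsto_add_atTop_nat 1)
  have := ht.div ((ht.pow 2).const_sub 1) (by simp)
  refine Tendsto.congr (fun k => ?_) (by simpa using this)
  simp [← pow_mul, mul_comm]

lemma summable_gapWeight {q : ℝ} (h0 : 0 < q) (h1 : q < 1) :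
    Summable fun l : List ℕ => q ^ gapWeight l := by
  rw [← (Equiv.sigmaFiberEquiv List.length).summable_iff]
  refine (summable_sigma_of_nonneg fun _ => by simp only [Function.comp_apply]; positivity).2
    ⟨fun k => (hasSum_gapWeight_length h0 h1 k).summable, ?_⟩
  exact (summable_oddEvenTerm h0 h1).congr fun k => (hasSum_gapWeight_length h0 h1 k).tsum_eq.symm

/-- Each 1 + 2d is odd, so modulo 2 the weight is 1 + 2 + ... + k for a list of length k. -/
lemma gapWeight_mod_two (l : List ℕ) :
    gapWeight l % 2 = (l.length * (l.length + 1) / 2) % 2 := by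
  induction l with
  | nil => rfl
  | cons d l ih =>
    have h : (l.length + 1) * (l.length + 1 + 1) / 2 =
        l.length * (l.length + 1) / 2 + (l.length + 1) := by
      rw [show (l.length + 1) * (l.length + 1 + 1) = l.length * (l.length + 1) +
        (l.length + 1) * 2 by ring, Nat.add_mul_div_right _ _ two_pos]
    rw [gapWeight, List.length_cons, h, mul_add, mul_one, mul_left_comm]
    omega

/-- A weighted sum over odd-even partitions, collected by size and by number of parts. -/
lemma hasSum_oddEvenCount_of_parity {q : ℝ} (h0 : 0 < q) (h1 : q < 1) (r : ℕ) :
    HasSum (fun n => if n % 2 = r then (oddEvenCount n : ℝ) * q ^ n else 0)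
      (∑' k, if (k * (k + 1) / 2) % 2 = r then oddEvenTerm q k else 0) := by
  have hs : Summable fun l : List ℕ => if gapWeight l % 2 = r then q ^ gapWeight l else 0 := by
    refine (summable_gapWeight h0 h1).of_nonneg_of_le (fun l => ?_) (fun l => ?_)
    · split_ifs <;> positivity
    · split_ifs
      · exact le_rfl
      · positivity
  have e1 := ((Equiv.sigmaFiberEquiv gapWeight).hasSum_iff.2 hs.hasSum).sigma
    (g := fun n => if n % 2 = r then (oddEvenCount n : ℝ) * q ^ n else 0) (fun n => by
      have h : ∀ l : {l : List ℕ // gapWeight l = n}, (if gapWeight l.1 % 2 = r then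
          q ^ gapWeight l.1 else 0) = if n % 2 = r then q ^ n else 0 := fun l => by rw [l.2]
      convert hasSum_fintype _ using 1
      · simp only [Function.comp_apply, Equiv.sigmaFiberEquiv_apply]
        rw [Finset.sum_congr rfl fun l _ => h l, Finset.sum_const, Finset.card_univ,
          card_gapWeight, nsmul_eq_mul, mul_ite, mul_zero])
  have e2 := ((Equiv.sigmaFiberEquiv List.length).hasSum_iff.2 hs.hasSum).sigma
    (g := fun k => if (k * (k + 1) / 2) % 2 = r then oddEvenTerm q k else 0) (fun k => by
      have h : ∀ l : {l : List ℕ // l.length = k}, (if gapWeight l.1 % 2 = r then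
          q ^ gapWeight l.1 else 0) =
          if (k * (k + 1) / 2) % 2 = r then q ^ gapWeight l.1 else 0 := fun l => by
        rw [gapWeight_mod_two, l.2]
      simp only [Function.comp_apply, Equiv.sigmaFiberEquiv_apply]
      rw [funext h]
      split_ifs
      · exact hasSum_gapWeight_length h0 h1 k
      · exact hasSum_zero)
  rwa [e2.tsum_eq]

/-- The parity of the triangular number k(k+1)/2 depends only on k mod 4. -/
lemma tsum_oddEvenTerm_residue {q : ℝ} (h0 : 0 < q) (h1 : q < 1) (r : ℕ) :
    (∑' k, if (k * (k + 1) / 2) % 2 = r then oddEvenTerm q k else 0) =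
      ∑ j : Fin 4, if (j.1 * (j.1 + 1) / 2) % 2 = r then ∑' m, oddEvenTerm q (4 * m + j) else 0 := by
  have hs : Summable fun k => if (k * (k + 1) / 2) % 2 = r then oddEvenTerm q k else 0 := by
    refine (summable_oddEvenTerm h0 h1).of_nonneg_of_le (fun k => ?_) (fun k => ?_)
    · split_ifs
      · exact (oddEvenTerm_pos h0 h1 k).le
      · exact le_rfl
    · split_ifs
      · exact le_rfl
      · exact (oddEvenTerm_pos h0 h1 k).le
  rw [Nat.sumByResidueClasses hs 4]
  refine Finset.sum_congr rfl fun j _ => ?_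
  have key : ∀ m : ℕ, ((j.1 + 4 * m) * (j.1 + 4 * m + 1) / 2) % 2 = (j.1 * (j.1 + 1) / 2) % 2 := by
    intro m
    rw [show (j.1 + 4 * m) * (j.1 + 4 * m + 1) =
      j.1 * (j.1 + 1) + 2 * (2 * (m * (2 * j.1 + 4 * m + 1))) by ring,
      Nat.add_mul_div_left _ _ two_pos, Nat.add_mul_mod_self_left]
  change ∑' m : ℕ, (if ((j.1 + 4 * m) * (j.1 + 4 * m + 1) / 2) % 2 = r then
    oddEvenTerm q (j.1 + 4 * m) else 0) = _
  simp only [key]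
  split_ifs
  · simp only [add_comm]
  · exact tsum_zero

lemma hasSum_oddEvenCount_even {q : ℝ} (h0 : 0 < q) (h1 : q < 1) :
    HasSum (fun n => (oddEvenCount (2 * n) : ℝ) * q ^ (2 * n))
      (∑' j, oddEvenTerm q (4 * j) + ∑' j, oddEvenTerm q (4 * j + 3)) := by
  have h := hasSum_oddEvenCount_of_parity h0 h1 0
  rw [tsum_oddEvenTerm_residue h0 h1] at h
  have hinj : Function.Injective fun n : ℕ => 2 * n := fun a b hab => by
    simp only at hab; omega
  rw [← hinj.hasSum_iff] at h
  · simpa [Fin.sum_univ_four, Function.comp_def] using h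
  · intro n hn
    rw [if_neg]
    intro h
    exact hn ⟨n / 2, by simp only; omega⟩

lemma hasSum_oddEvenCount_odd {q : ℝ} (h0 : 0 < q) (h1 : q < 1) :
    HasSum (fun n => (oddEvenCount (2 * n + 1) : ℝ) * q ^ (2 * n + 1))
      (∑' j, oddEvenTerm q (4 * j + 1) + ∑' j, oddEvenTerm q (4 * j + 2)) := by
  have h := hasSum_oddEvenCount_of_parity h0 h1 1
  rw [tsum_oddEvenTerm_residue h0 h1] at h
  have hinj : Function.Injective fun n : ℕ => 2 * n + 1 := fun a b hab => by
    simp only at hab; omega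
  rw [← hinj.hasSum_iff] at h
  · have h2 : ∀ x : ℕ, (2 * x + 1) % 2 = 1 := fun x => by omega
    simpa [Fin.sum_univ_four, Function.comp_def, h2] using h
  · intro n hn
    rw [if_neg]
    intro h
    exact hn ⟨n / 2, by simp only; omega⟩

/-! ### The dilogarithm -/

/-- The real dilogarithm, for `|x| ≤ 1`. -/
noncomputable def dilog (x : ℝ) : ℝ := ∑' n : ℕ, x ^ (n + 1) / ((n : ℝ) + 1) ^ 2

lemma summable_one_div_succ_sq : Summable fun n : ℕ => 1 / ((n : ℝ) + 1) ^ 2 := by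
  have := (summable_nat_add_iff 1).2 (Real.summable_one_div_nat_pow.2 one_lt_two)
  simpa using this

lemma norm_dilog_term_le {x : ℝ} (hx : |x| ≤ 1) (n : ℕ) :
    ‖x ^ (n + 1) / ((n : ℝ) + 1) ^ 2‖ ≤ 1 / ((n : ℝ) + 1) ^ 2 := by
  rw [norm_div, norm_pow, Real.norm_eq_abs, Real.norm_of_nonneg (by positivity)]
  gcongr
  exact pow_le_one₀ (abs_nonneg _) hx

lemma summable_dilog {x : ℝ} (hx : |x| ≤ 1) :
    Summable fun n : ℕ => x ^ (n + 1) / ((n : ℝ) + 1) ^ 2 :=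
  summable_one_div_succ_sq.of_norm_bounded (norm_dilog_term_le hx)

lemma continuousOn_dilog : ContinuousOn dilog (Set.Icc (-1) 1) :=
  continuousOn_tsum (fun n => by fun_prop) summable_one_div_succ_sq
    fun n _ hx => norm_dilog_term_le (abs_le.2 hx) n

lemma dilog_zero : dilog 0 = 0 := by simp [dilog]

lemma dilog_one : dilog 1 = Real.pi ^ 2 / 6 := by
  have h := (hasSum_nat_add_iff' 1).2 hasSum_zeta_two
  simpa [dilog] using h.tsum_eq

lemma hasDerivAt_dilog {x : ℝ} (hx : |x| < 1) (h0 : x ≠ 0) :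
    HasDerivAt dilog (-Real.log (1 - x) / x) x := by
  -- On the ball of radius r the differentiated terms are dominated by r^n, which allows termwise
  -- differentiation at x.
  obtain ⟨r, hxr, hr⟩ := exists_between hx
  have hr0 : 0 < r := (abs_nonneg x).trans_lt hxr
  have h := hasDerivAt_tsum_of_isPreconnected (𝕜 := ℝ) (F := ℝ)
    (g := fun (n : ℕ) (x : ℝ) => x ^ (n + 1) / ((n : ℝ) + 1) ^ 2)
    (g' := fun n x => x ^ n / ((n : ℝ) + 1)) (u := fun n => r ^ n) (t := Metric.ball 0 r)
    (y₀ := 0) (y := x) (summable_geometric_of_lt_one hr0.le hr) Metric.isOpen_ball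
    (convex_ball _ _).isPreconnected (fun n y _ => ?_) (fun n y hy => ?_) (by simpa using hr0)
    (by simp [summable_zero]) (by simpa using hxr)
  · refine HasDerivAt.congr_deriv h ?_
    have hl := (Real.hasSum_pow_div_log_of_abs_lt_one hx).div_const x
    rw [← hl.tsum_eq]
    refine tsum_congr fun n => ?_
    field_simp
    exact (pow_succ x n).symm
  · refine ((hasDerivAt_pow (n + 1) y).div_const _).congr_deriv ?_
    have : (n : ℝ) + 1 ≠ 0 := by positivity
    push_cast
    field_simp
  · rw [norm_div, norm_pow, Real.norm_of_nonneg (by positivity : (0 : ℝ) ≤ (n : ℝ) + 1)]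
    have hy' : ‖y‖ ≤ r := by simpa using (Metric.mem_ball.1 hy).le
    refine (div_le_self (by positivity) (by linarith [n.cast_nonneg (α := ℝ)])).trans ?_
    gcongr

lemma eq_of_hasDerivAt_zero_Ioo {f : ℝ → ℝ} {a b : ℝ} (hab : a ≤ b)
    (hc : ContinuousOn f (Set.Icc a b)) (hd : ∀ x ∈ Set.Ioo a b, HasDerivAt f 0 x) : f a = f b := by
  rcases hab.eq_or_lt with rfl | hab
  · rfl
  obtain ⟨c, hc, h⟩ := exists_hasDerivAt_eq_slope f (fun _ => 0) hab hc hd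
  have : b - a ≠ 0 := (sub_pos.2 hab).ne'
  field_simp at h
  linarith

/-- Landen's identity. -/
lemma dilog_landen {x : ℝ} (h0 : 0 ≤ x) (h1 : x < 1) :
    dilog (-x) + dilog (x / (1 + x)) + Real.log (1 + x) ^ 2 / 2 = 0 := by
  have h := eq_of_hasDerivAt_zero_Ioo
    (f := fun x => dilog (-x) + dilog (x / (1 + x)) + Real.log (1 + x) ^ 2 / 2) h0 ?_ ?_
  · simpa [dilog_zero] using h.symm
  · have hne : ∀ y ∈ Set.Icc 0 x, 1 + y ≠ 0 := fun y hy => by linarith [hy.1]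
    refine ContinuousOn.add (ContinuousOn.add ?_ ?_) ?_
    · exact continuousOn_dilog.comp (by fun_prop) fun y hy => ⟨by linarith [hy.2], by linarith [hy.1]⟩
    · refine continuousOn_dilog.comp (ContinuousOn.div (by fun_prop) (by fun_prop) hne)
        fun y hy => ⟨?_, ?_⟩
      · have := div_nonneg hy.1 (by linarith [hy.1] : 0 ≤ 1 + y); linarith
      · exact (div_le_one (by linarith [hy.1])).2 (by linarith)
    · exact ((ContinuousOn.log (by fun_prop) hne).pow 2).div_const 2
  · intro y hy
    have hy0 : 0 < y := hy.1
    have hy1 : y < 1 := hy.2.trans h1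
    have hp : 0 < 1 + y := by linarith
    have hq : y / (1 + y) < 1 := (div_lt_one hp).2 (by linarith)
    have d1 := (hasDerivAt_dilog (x := -y) (by rwa [abs_neg, abs_of_pos hy0]) (by linarith)).comp y
      (hasDerivAt_neg y)
    have d2 := (hasDerivAt_dilog (x := y / (1 + y)) (by rwa [abs_of_pos (by positivity)])
      (by positivity)).comp y ((hasDerivAt_id y).div ((hasDerivAt_id y).const_add 1) hp.ne')
    have d3 := ((((hasDerivAt_id y).const_add 1).log hp.ne').pow 2).div_const 2
    refine ((d1.add d2).add d3).congr_deriv ?_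
    have e : 1 - y / (1 + y) = (1 + y)⁻¹ := by field_simp; ring
    simp only [id, e, Real.log_inv, sub_neg_eq_add]
    field_simp
    ring

/-- Euler's reflection identity. -/
lemma dilog_reflection {x : ℝ} (h0 : 0 < x) (h1 : x < 1) :
    dilog x + dilog (1 - x) + Real.log x * Real.log (1 - x) = Real.pi ^ 2 / 6 := by
  -- The left side of the identity has derivative zero on (0, 1). Its constant value is read off as
  -- y → 0⁺, where log(1 - y) = O(y) beats the singularity of log y.
  have hlim : Tendsto (fun y : ℝ => Real.log y * Real.log (1 - y)) (𝓝[>] 0) (𝓝 0) := by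
    have hd : HasDerivAt (fun y : ℝ => Real.log (1 - y)) (-1) 0 := by
      simpa using ((hasDerivAt_id (0 : ℝ)).const_sub 1).log (by simp)
    have hO : (fun y : ℝ => Real.log (1 - y)) =O[𝓝[>] 0] fun y => y := by
      simpa using hd.isBigO_sub.mono nhdsWithin_le_nhds
    have hl : Tendsto (fun y : ℝ => Real.log y * y) (𝓝[>] 0) (𝓝 0) := by
      simpa using tendsto_log_mul_rpow_nhdsGT_zero one_pos
    exact ((isBigO_refl _ _).mul hO).trans_tendsto hl
  have hconst : ∀ y ∈ Set.Ioo 0 x, dilog y + dilog (1 - y) + Real.log y * Real.log (1 - y) =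
      dilog x + dilog (1 - x) + Real.log x * Real.log (1 - x) := by
    intro y hy
    refine eq_of_hasDerivAt_zero_Ioo
      (f := fun x => dilog x + dilog (1 - x) + Real.log x * Real.log (1 - x)) hy.2.le ?_ ?_
    · refine ContinuousOn.add (ContinuousOn.add ?_ ?_) (ContinuousOn.mul ?_ ?_)
      · exact continuousOn_dilog.mono fun z hz => ⟨by linarith [hz.1, hy.1], by linarith [hz.2]⟩
      · exact continuousOn_dilog.comp (by fun_prop)
          fun z hz => ⟨by linarith [hz.2], by linarith [hz.1, hy.1]⟩
      · exact ContinuousOn.log (by fun_prop) fun z hz => by linarith [hz.1, hy.1]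
      · exact ContinuousOn.log (by fun_prop) fun z hz => by linarith [hz.2]
    · intro z hz
      have hz0 : 0 < z := hy.1.trans hz.1
      have hz1 : z < 1 := hz.2.trans h1
      have hz2 : 0 < 1 - z := by linarith
      have d1 := hasDerivAt_dilog (x := z) (by rwa [abs_of_pos hz0]) hz0.ne'
      have d2 := (hasDerivAt_dilog (x := 1 - z) (by rw [abs_of_pos hz2]; linarith) hz2.ne').comp z
        ((hasDerivAt_id z).const_sub 1)
      have d3 := (hasDerivAt_id z).log hz0.ne'
      have d4 := ((hasDerivAt_id z).const_sub 1).log hz2.ne'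
      refine ((d1.add d2).add (d3.mul d4)).congr_deriv ?_
      simp only [id, sub_sub_cancel]
      field_simp
      ring
  have hcont : ∀ c ∈ Set.Icc (0 : ℝ) 1, ContinuousWithinAt dilog (Set.Icc (-1) 1) c :=
    fun c hc => continuousOn_dilog c ⟨by linarith [hc.1], hc.2⟩
  have hI : Set.Ioo (0 : ℝ) x ∈ 𝓝[>] 0 := Ioo_mem_nhdsGT h0
  have t1 : Tendsto dilog (𝓝[>] 0) (𝓝 0) := by
    have := (hcont 0 (by simp)).tendsto
    rw [dilog_zero] at this
    refine this.mono_left (le_inf inf_le_left (le_principal_iff.2 ?_))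
    filter_upwards [hI] with y hy using ⟨by linarith [hy.1], by linarith [hy.2]⟩
  have t2 : Tendsto (fun y => dilog (1 - y)) (𝓝[>] 0) (𝓝 (Real.pi ^ 2 / 6)) := by
    have := (hcont 1 (by simp)).tendsto
    rw [dilog_one] at this
    refine this.comp (tendsto_inf.2 ⟨?_, tendsto_principal.2 ?_⟩)
    · have : Tendsto (fun y : ℝ => 1 - y) (𝓝 0) (𝓝 (1 - 0)) := by
        exact (continuous_const.sub continuous_id).tendsto 0
      rw [sub_zero] at this
      exact this.mono_left nhdsWithin_le_nhds
    · filter_upwards [hI] with y hy using ⟨by linarith [hy.2], by linarith [hy.1]⟩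
  have t := (t1.add t2).add hlim
  rw [zero_add, add_zero] at t
  refine tendsto_nhds_unique (tendsto_const_nhds.congr' ?_) t
  filter_upwards [hI] with y hy using (hconst y hy).symm

lemma dilog_add_dilog_neg {x : ℝ} (hx : |x| ≤ 1) : dilog x + dilog (-x) = dilog (x ^ 2) / 2 := by
  have h1 := (summable_dilog hx).hasSum.add (summable_dilog (x := -x) (by rwa [abs_neg])).hasSum
  have hinj : Function.Injective fun n : ℕ => 2 * n + 1 := fun a b hab => by
    simp only at hab; omega
  rw [← hinj.hasSum_iff] at h1
  · refine h1.unique ?_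
    have h2 := (summable_dilog (x := x ^ 2) (by
      rw [abs_pow]; exact pow_le_one₀ (abs_nonneg _) hx)).hasSum.div_const 2
    refine Eq.mp (congrArg (HasSum · _) (funext fun n => ?_)) h2
    simp only [Function.comp_apply]
    rw [Even.neg_pow ⟨n + 1, by ring⟩, ← pow_mul]
    push_cast
    have : (n : ℝ) + 1 ≠ 0 := by positivity
    field_simp
    ring
  · intro n hn
    have : Odd (n + 1) := by
      rw [Nat.odd_iff]
      by_contra h
      exact hn ⟨n / 2, by simp only; omega⟩
    rw [this.neg_pow]
    ring

/-- A special value of the dilogarithm at the square of the inverse golden ratio. -/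
lemma dilog_of_sq_eq_one_sub {x : ℝ} (h0 : 0 < x) (h1 : x < 1) (hx : x ^ 2 = 1 - x) :
    dilog (x ^ 2) = Real.pi ^ 2 / 15 - Real.log x ^ 2 := by
  have e1 := dilog_reflection h0 h1
  have e2 := dilog_landen h0.le h1
  have e3 := dilog_add_dilog_neg (x := x) (by rw [abs_of_pos h0]; exact h1.le)
  -- Now x/(1 + x) = x² and log(1 - x) = 2 log x, so the three identities form a linear system in
  -- Li₂(x), Li₂(-x), Li₂(x²). Adding the first two and eliminating Li₂(x) + Li₂(-x) leaves (5/2)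
  -- Li₂(x²).
  have hp : 1 + x = x⁻¹ := by field_simp; nlinarith
  rw [← hx, Real.log_pow] at e1
  rw [hp, div_inv_eq_mul, ← sq, Real.log_inv] at e2
  push_cast at e1
  nlinarith

/-! ### A logarithm of the `q`-Pochhammer symbol -/

lemma exp_neg_lt_one {u : ℝ} (hu : 0 < u) : Real.exp (-u) < 1 :=
  Real.exp_lt_one_iff.2 (neg_lt_zero.2 hu)

/-- Equivalent to 2 - u ≤ (2 + u)e^(-u). The difference vanishes at 0 and has derivative 1 - (1 +
u)e^(-u) ≥ 0. -/
lemma inv_add_half_le_one_div_one_sub_exp {u : ℝ} (hu : 0 < u) :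
    1 / u + 1 / 2 ≤ 1 / (1 - Real.exp (-u)) := by
  have hpos : 0 < 1 - Real.exp (-u) := by
    have := exp_neg_lt_one hu; linarith
  have hmono : MonotoneOn (fun v : ℝ => (2 + v) * Real.exp (-v) - (2 - v)) (Set.Ici 0) := by
    refine monotoneOn_of_deriv_nonneg (convex_Ici 0) (by fun_prop) (by fun_prop) fun v hv => ?_
    have hd : HasDerivAt (fun v : ℝ => (2 + v) * Real.exp (-v) - (2 - v))
        (1 * Real.exp (-v) + (2 + v) * (Real.exp (-v) * (-1)) - (-1)) v :=
      (((hasDerivAt_id v).const_add 2).mul ((hasDerivAt_neg v).exp)).sub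
        ((hasDerivAt_id v).const_sub 2)
    rw [hd.deriv]
    have h1 := Real.add_one_le_exp v
    have h2 : Real.exp v * Real.exp (-v) = 1 := by rw [← Real.exp_add]; simp
    nlinarith [Real.exp_pos (-v), mul_le_mul_of_nonneg_right h1 (Real.exp_pos (-v)).le]
  have h := hmono (Set.self_mem_Ici) (Set.mem_Ici.2 hu.le) hu.le
  simp only [neg_zero, Real.exp_zero] at h
  rw [div_add_div _ _ hu.ne' two_ne_zero, div_le_div_iff₀ (by positivity) hpos]
  nlinarith

/-- The bound e^u ≥ 1 + u + u²/2 suffices, because (2 - u + u²)(1 + u + u²/2) exceeds 2 + u + u² by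
u³/2 + u⁴/2. -/
lemma one_div_one_sub_exp_le {u : ℝ} (hu : 0 < u) :
    1 / (1 - Real.exp (-u)) ≤ 1 / u + 1 / 2 + u / 2 := by
  have hpos : 0 < 1 - Real.exp (-u) := by
    have := exp_neg_lt_one hu; linarith
  have h1 := Real.quadratic_le_exp_of_nonneg hu.le
  have h2 : Real.exp u * Real.exp (-u) = 1 := by rw [← Real.exp_add]; simp
  have h3 := mul_le_mul_of_nonneg_right h1 (Real.exp_pos (-u)).le
  rw [h2] at h3
  have h4 : (2 + u + u ^ 2) * Real.exp (-u) ≤ 2 - u + u ^ 2 := by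
    have h5 : 2 + u + u ^ 2 ≤ (2 - u + u ^ 2) * (1 + u + u ^ 2 / 2) := by
      have : 0 ≤ u ^ 3 / 2 + u ^ 4 / 2 := by positivity
      nlinarith
    have h6 : 0 ≤ 2 - u + u ^ 2 := by nlinarith [sq_nonneg (u - 1)]
    nlinarith [mul_le_mul_of_nonneg_right h5 (Real.exp_pos (-u)).le,
      mul_le_mul_of_nonneg_left h3 h6]
  rw [div_le_iff₀ hpos]
  field_simp
  nlinarith

/-- The sum `∑ xⁿ / (n (1 - e^{-s n}))`, which is `-log ∏ (1 - x e^{-s j})` over `j ≥ 0`. -/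
noncomputable def negLogPochhammer (s x : ℝ) : ℝ :=
  ∑' n : ℕ, x ^ (n + 1) / ((n : ℝ) + 1) * (1 / (1 - Real.exp (-(s * ((n : ℝ) + 1)))))

lemma hasSum_dilog_div_add {s x : ℝ} (hx0 : 0 ≤ x) (hx1 : x < 1) :
    HasSum (fun n : ℕ => x ^ (n + 1) / ((n : ℝ) + 1) * (1 / (s * ((n : ℝ) + 1)) + 1 / 2))
      (dilog x / s - Real.log (1 - x) / 2) := by
  have hx : |x| < 1 := by rwa [abs_of_nonneg hx0]
  have h := ((summable_dilog hx.le).hasSum.div_const s).add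
    ((Real.hasSum_pow_div_log_of_abs_lt_one hx).div_const 2)
  rw [neg_div, ← sub_eq_add_neg] at h
  refine Eq.mp (congrArg (HasSum · _) (funext fun n => ?_)) h
  have : (n : ℝ) + 1 ≠ 0 := by positivity
  -- At s = 0 both quotients by s are zero by convention, and the identity persists.
  rcases eq_or_ne s 0 with rfl | hs
  · simp; ring
  · field_simp

lemma hasSum_dilog_div_add_add {s x : ℝ} (hs : 0 < s) (hx0 : 0 ≤ x) (hx1 : x < 1) :
    HasSum (fun n : ℕ => x ^ (n + 1) / ((n : ℝ) + 1) *
        (1 / (s * ((n : ℝ) + 1)) + 1 / 2 + s * ((n : ℝ) + 1) / 2))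
      (dilog x / s - Real.log (1 - x) / 2 + s / 2 * (x / (1 - x))) := by
  have h := (hasSum_dilog_div_add (s := s) hx0 hx1).add
    (((hasSum_geometric_of_lt_one hx0 hx1).mul_left x).mul_left (s / 2))
  rw [← div_eq_mul_inv] at h
  refine Eq.mp (congrArg (HasSum · _) (funext fun n => ?_)) h
  have : (n : ℝ) + 1 ≠ 0 := by positivity
  field_simp
  ring

lemma negLogPochhammer_term_nonneg {s x : ℝ} (hs : 0 < s) (hx0 : 0 ≤ x) (n : ℕ) :
    0 ≤ x ^ (n + 1) / ((n : ℝ) + 1) * (1 / (1 - Real.exp (-(s * ((n : ℝ) + 1))))) := by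
  have h := inv_add_half_le_one_div_one_sub_exp (u := s * ((n : ℝ) + 1)) (by positivity)
  have : 0 ≤ 1 / (s * ((n : ℝ) + 1)) + 1 / 2 := by positivity
  exact mul_nonneg (by positivity) (this.trans h)

lemma summable_negLogPochhammer {s x : ℝ} (hs : 0 < s) (hx0 : 0 ≤ x) (hx1 : x < 1) :
    Summable fun n : ℕ =>
      x ^ (n + 1) / ((n : ℝ) + 1) * (1 / (1 - Real.exp (-(s * ((n : ℝ) + 1))))) := by
  refine (hasSum_dilog_div_add_add hs hx0 hx1).summable.of_nonneg_of_le
    (negLogPochhammer_term_nonneg hs hx0) fun n => ?_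
  have := one_div_one_sub_exp_le (u := s * ((n : ℝ) + 1)) (by positivity)
  gcongr

lemma negLogPochhammer_nonneg {s x : ℝ} (hs : 0 < s) (hx0 : 0 ≤ x) :
    0 ≤ negLogPochhammer s x :=
  tsum_nonneg (negLogPochhammer_term_nonneg hs hx0)

lemma le_negLogPochhammer {s x : ℝ} (hs : 0 < s) (hx0 : 0 ≤ x) (hx1 : x < 1) :
    dilog x / s - Real.log (1 - x) / 2 ≤ negLogPochhammer s x := by
  refine hasSum_le (fun n => ?_) (hasSum_dilog_div_add hx0 hx1)
    (summable_negLogPochhammer hs hx0 hx1).hasSum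
  have := inv_add_half_le_one_div_one_sub_exp (u := s * ((n : ℝ) + 1)) (by positivity)
  gcongr

lemma negLogPochhammer_le {s x : ℝ} (hs : 0 < s) (hx0 : 0 ≤ x) (hx1 : x < 1) :
    negLogPochhammer s x ≤ dilog x / s - Real.log (1 - x) / 2 + s / 2 * (x / (1 - x)) := by
  refine hasSum_le (fun n => ?_) (summable_negLogPochhammer hs hx0 hx1).hasSum
    (hasSum_dilog_div_add_add hs hx0 hx1)
  have := one_div_one_sub_exp_le (u := s * ((n : ℝ) + 1)) (by positivity)
  gcongr

/-- The factor 1 - e^(-sn) cancels the denominator and leaves the logarithm series. This functional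
equation makes finite products telescope. -/
lemma negLogPochhammer_sub {s x : ℝ} (hs : 0 < s) (hx0 : 0 ≤ x) (hx1 : x < 1) :
    negLogPochhammer s x - negLogPochhammer s (x * Real.exp (-s)) = -Real.log (1 - x) := by
  have he : Real.exp (-s) < 1 := exp_neg_lt_one hs
  have h1 := (summable_negLogPochhammer hs hx0 hx1).hasSum
  have h2 := (summable_negLogPochhammer hs (x := x * Real.exp (-s)) (by positivity)
    (by nlinarith [Real.exp_pos (-s)])).hasSum
  refine (h1.sub h2).unique (Eq.mp (congrArg (HasSum · _) (funext fun n => ?_))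
    (Real.hasSum_pow_div_log_of_abs_lt_one (x := x) (by rwa [abs_of_nonneg hx0])))
  have hn : (n : ℝ) + 1 ≠ 0 := by positivity
  have hlt : Real.exp (-(s * ((n : ℝ) + 1))) < 1 :=
    exp_neg_lt_one (by positivity)
  have hp : Real.exp (-s) ^ (n + 1) = Real.exp (-(s * ((n : ℝ) + 1))) := by
    rw [← Real.exp_nat_mul]; push_cast; ring_nf
  rw [mul_pow, hp]
  have : 1 - Real.exp (-(s * ((n : ℝ) + 1))) ≠ 0 := by linarith
  generalize Real.exp (-(s * ((n : ℝ) + 1))) = y at this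
  field_simp

lemma exp_neg_mul_pow (s : ℝ) (k : ℕ) :
    Real.exp (-s) ^ k = Real.exp (-(s * k)) := by
  rw [← Real.exp_nat_mul]; ring_nf

/-- The finite product `∏_{j=1}^k (1 - e^{-s j})` in terms of `negLogPochhammer`. -/
lemma prod_one_sub_exp_pow {s : ℝ} (hs : 0 < s) (k : ℕ) :
    ∏ j ∈ Finset.range k, (1 - Real.exp (-s) ^ (j + 1)) =
      Real.exp (negLogPochhammer s (Real.exp (-s) ^ (k + 1)) -
        negLogPochhammer s (Real.exp (-s))) := by
  have he : Real.exp (-s) < 1 := exp_neg_lt_one hs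
  induction k with
  | zero => simp
  | succ k ih =>
    have hx : Real.exp (-s) ^ (k + 1) < 1 := pow_lt_one₀ (Real.exp_pos _).le he (by omega)
    have h := negLogPochhammer_sub hs (x := Real.exp (-s) ^ (k + 1)) (by positivity) hx
    rw [← pow_succ] at h
    rw [Finset.prod_range_succ, ih,
      ← Real.exp_log (sub_pos.2 hx), ← Real.exp_add]
    congr 1
    linarith

/-- Both parameters vary because two limits are needed: x → 0 with s fixed, for the infinite
product, and s → ∞ with x = e^(-s). -/
lemma tendsto_negLogPochhammer_upper {ι : Type*} {l : Filter ι} {s x : ι → ℝ}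
    (hs : ∀ᶠ i in l, 0 < s i) (hx : ∀ᶠ i in l, 0 ≤ x i) (hx0 : Tendsto x l (𝓝 0))
    (h1 : Tendsto (fun i => dilog (x i) / s i) l (𝓝 0))
    (h2 : Tendsto (fun i => s i * x i) l (𝓝 0)) :
    Tendsto (fun i => negLogPochhammer (s i) (x i)) l (𝓝 0) := by
  have hx1 : ∀ᶠ i in l, x i < 1 := hx0.eventually_lt_const one_pos
  have h3 : Tendsto (fun i => 1 - x i) l (𝓝 1) := by simpa using hx0.const_sub 1
  have h4 : Tendsto (fun i => Real.log (1 - x i)) l (𝓝 0) := by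
    simpa using h3.log one_ne_zero
  have hu : Tendsto (fun i => dilog (x i) / s i - Real.log (1 - x i) / 2 +
      (s i * x i) / (1 - x i) / 2) l (𝓝 0) := by
    simpa using (h1.sub (h4.div_const 2)).add ((h2.div h3 one_ne_zero).div_const 2)
  refine tendsto_of_tendsto_of_tendsto_of_le_of_le' tendsto_const_nhds hu ?_ ?_
  · filter_upwards [hs, hx] with i hs hx using negLogPochhammer_nonneg hs hx
  · filter_upwards [hs, hx, hx1] with i hs hx hx1
    refine (negLogPochhammer_le hs hx hx1).trans (le_of_eq ?_)
    ring

lemma tendsto_dilog_zero {ι : Type*} {l : Filter ι} {x : ι → ℝ} (hx0 : Tendsto x l (𝓝 0)) :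
    Tendsto (fun i => dilog (x i)) l (𝓝 0) := by
  have := (continuousOn_dilog.continuousAt (Icc_mem_nhds (by norm_num : (-1 : ℝ) < 0) one_pos))
  have h := this.tendsto.comp hx0
  rwa [dilog_zero] at h

/-! ### The Euler product and its inversion -/

/-- The infinite product `∏_{j≥1} (1 - e^{-s j})`. -/
noncomputable def eulerProd (s : ℝ) : ℝ := ∏' j : ℕ, (1 - Real.exp (-s) ^ (j + 1))

lemma multipliable_eulerProd {s : ℝ} (hs : 0 < s) :
    Multipliable fun j : ℕ => 1 - Real.exp (-s) ^ (j + 1) := by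
  have he : Real.exp (-s) < 1 := exp_neg_lt_one hs
  simp only [sub_eq_add_neg]
  refine multipliable_one_add_of_summable ?_
  simpa using (summable_nat_add_iff 1).2 (summable_geometric_of_lt_one (Real.exp_pos (-s)).le he)

lemma eulerProd_eq_exp {s : ℝ} (hs : 0 < s) :
    eulerProd s = Real.exp (-negLogPochhammer s (Real.exp (-s))) := by
  have he : Real.exp (-s) < 1 := exp_neg_lt_one hs
  have hx : Tendsto (fun k : ℕ => Real.exp (-s) ^ (k + 1)) atTop (𝓝 0) :=
    (tendsto_pow_atTop_nhds_zero_of_lt_one (Real.exp_pos _).le he).comp (tendsto_add_atTop_nat 1)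
  have h := tendsto_negLogPochhammer_upper (s := fun _ => s) (Eventually.of_forall fun _ => hs)
    (Eventually.of_forall fun _ => by positivity) hx
    (by simpa using (tendsto_dilog_zero hx).div_const s) (by simpa using hx.const_mul s)
  refine tendsto_nhds_unique (multipliable_eulerProd hs).hasProd.tendsto_prod_nat ?_
  simp only [prod_one_sub_exp_pow hs]
  have := (h.sub_const (negLogPochhammer s (Real.exp (-s)))).rexp
  simpa using this

lemma eulerProd_pos {s : ℝ} (hs : 0 < s) : 0 < eulerProd s := by
  rw [eulerProd_eq_exp hs]; exact Real.exp_pos _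

/-- Inversion produces the parameter 2π²/e, which tends to infinity; this makes the dual product
negligible. -/
lemma tendsto_eulerProd_atTop : Tendsto eulerProd atTop (𝓝 1) := by
  have hx : Tendsto (fun s : ℝ => Real.exp (-s)) atTop (𝓝 0) :=
    Real.tendsto_exp_neg_atTop_nhds_zero
  have h := tendsto_negLogPochhammer_upper (s := fun s => s) (eventually_gt_atTop 0)
    (Eventually.of_forall fun _ => (Real.exp_pos _).le) hx
    ((tendsto_dilog_zero hx).div_atTop tendsto_id)
    (by simpa using Real.tendsto_pow_mul_exp_neg_atTop_nhds_zero 1)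
  have h2 := h.neg.rexp
  rw [neg_zero, Real.exp_zero] at h2
  refine h2.congr' ?_
  filter_upwards [eventually_gt_atTop 0] with s hs using (eulerProd_eq_exp hs).symm

lemma norm_eta_mul_I {t : ℝ} (ht : 0 < t) :
    ‖ModularForm.eta (t * Complex.I)‖ =
      Real.exp (-(Real.pi * t / 12)) * eulerProd (2 * Real.pi * t) := by
  have hs : 0 < 2 * Real.pi * t := by positivity
  have h : ∏' n, (1 - ModularForm.eta_q n (t * Complex.I)) =
      ((eulerProd (2 * Real.pi * t) : ℝ) : ℂ) := by
    have hm := (multipliable_eulerProd hs).map_tprod Complex.ofRealHom Complex.continuous_ofReal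
    rw [Complex.ofRealHom_eq_coe] at hm
    rw [eulerProd, hm]
    refine tprod_congr fun n => ?_
    rw [ModularForm.eta_q_eq_pow]
    simp only [Complex.ofRealHom_eq_coe]
    push_cast
    congr 3
    linear_combination (2 * Real.pi * t : ℂ) * Complex.I_sq
  rw [ModularForm.eta, norm_mul, h, Complex.norm_real, Real.norm_of_nonneg (eulerProd_pos hs).le,
    Function.Periodic.norm_qParam]
  congr 2
  simp
  ring

/-- The inversion formula for the Euler product, from that of the Dedekind eta function. -/
lemma eulerProd_inversion {e : ℝ} (he : 0 < e) :
    eulerProd (2 * e) = Real.sqrt (Real.pi / e) *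
      Real.exp (e / 12 - Real.pi ^ 2 / (12 * e)) * eulerProd (2 * Real.pi ^ 2 / e) := by
  have hpi := Real.pi_pos
  -- At z = ie/π the nome e^(2πiz) is e^(-2e), and -1/z = iπ/e. Norms are taken below to avoid
  -- choosing a branch of the square root.
  have ht : 0 < e / Real.pi := by positivity
  have h := ModularForm.eta_comp_eq_csqrt_I_inv
    (show ((e / Real.pi : ℝ) * Complex.I : ℂ) ∈ UpperHalfPlane.upperHalfPlaneSet by
      simpa using ht)
  have hz : -1 / (((e / Real.pi : ℝ) : ℂ) * Complex.I) = ((Real.pi / e : ℝ) : ℂ) * Complex.I := by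
    have h1 : (e : ℂ) ≠ 0 := by exact_mod_cast he.ne'
    have h2 : (Real.pi : ℂ) ≠ 0 := by exact_mod_cast hpi.ne'
    push_cast
    field_simp
    linear_combination -(Complex.I_sq)
  have hsqrt : ∀ z : ℂ, ‖Complex.sqrt z‖ = Real.sqrt ‖z‖ := fun z => by
    rw [Complex.sqrt, Real.sqrt_eq_rpow, ← Complex.norm_cpow_real]
    norm_num
  simp only [Function.comp_apply, Pi.smul_apply, Pi.mul_apply, smul_eq_mul, hz] at h
  have h' := congrArg (fun z : ℂ => ‖z‖) h
  simp only [norm_mul, norm_inv, hsqrt, norm_eta_mul_I ht, norm_eta_mul_I (t := Real.pi / e)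
    (by positivity), Complex.norm_I, Real.sqrt_one, inv_one, one_mul, Complex.norm_real, mul_one,
    Real.norm_of_nonneg ht.le] at h'
  have e1 : 2 * Real.pi * (e / Real.pi) = 2 * e := by field_simp
  have e2 : 2 * Real.pi * (Real.pi / e) = 2 * Real.pi ^ 2 / e := by ring
  have e3 : Real.pi * (e / Real.pi) / 12 = e / 12 := by field_simp
  have e4 : Real.pi * (Real.pi / e) / 12 = Real.pi ^ 2 / (12 * e) := by field_simp
  rw [e1, e2, e3, e4, Real.exp_neg (e / 12)] at h'
  rw [sub_eq_add_neg, Real.exp_add, mul_assoc, mul_assoc, h', ← inv_div e, Real.sqrt_inv]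
  have := Real.sqrt_pos.2 ht
  field_simp

/-! ### Asymptotics of a single term -/

lemma inv_goldenRatio_sq : (Real.goldenRatio⁻¹) ^ 2 = 1 - Real.goldenRatio⁻¹ := by
  have h := Real.goldenRatio_sq
  have h0 := Real.goldenRatio_ne_zero
  generalize Real.goldenRatio = g at h h0
  field_simp
  linarith

lemma inv_goldenRatio_lt_one : Real.goldenRatio⁻¹ < 1 :=
  inv_lt_one_of_one_lt₀ Real.one_lt_goldenRatio

lemma exp_neg_log_goldenRatio : Real.exp (-Real.log Real.goldenRatio) = Real.goldenRatio⁻¹ := by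
  rw [Real.exp_neg, Real.exp_log Real.goldenRatio_pos]

lemma exp_neg_two_mul_log_goldenRatio :
    Real.exp (-(2 * Real.log Real.goldenRatio)) = 1 - Real.goldenRatio⁻¹ := by
  rw [← inv_goldenRatio_sq, ← exp_neg_log_goldenRatio, ← Real.exp_nat_mul]
  ring_nf

lemma log_goldenRatio_pos : 0 < Real.log Real.goldenRatio :=
  Real.log_pos Real.one_lt_goldenRatio

/-! ### The rate function and its minimum -/

/-- The rate function `t²/2 + Li₂(e^{-2t})/2`. -/
noncomputable def rateFun (t : ℝ) : ℝ := t ^ 2 / 2 + dilog (Real.exp (-(2 * t))) / 2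

lemma rateFun_log_goldenRatio : rateFun (Real.log Real.goldenRatio) = Real.pi ^ 2 / 30 := by
  have h := dilog_of_sq_eq_one_sub (inv_pos.2 Real.goldenRatio_pos) inv_goldenRatio_lt_one
    inv_goldenRatio_sq
  rw [inv_goldenRatio_sq, Real.log_inv, neg_sq] at h
  rw [rateFun, exp_neg_two_mul_log_goldenRatio, h]
  ring

/-- Each term of Li₂(e^(-2t)) is convex in t and lies above its tangent at t₀. The tangents sum to a
linear function whose slope cancels that of t²/2, since t₀ is critical; only (t - t₀)²/2 is left. -/
lemma rateFun_lower {t : ℝ} (ht : 0 < t) :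
    rateFun (Real.log Real.goldenRatio) + (t - Real.log Real.goldenRatio) ^ 2 / 2 ≤ rateFun t := by
  set t₀ := Real.log Real.goldenRatio with ht₀
  set z := Real.exp (-(2 * t₀)) with hz
  have hz1 : |z| < 1 := by
    rw [abs_of_pos (Real.exp_pos _)]
    exact exp_neg_lt_one (by have := log_goldenRatio_pos; positivity)
  have hw1 : |Real.exp (-(2 * t))| ≤ 1 := by
    rw [abs_of_pos (Real.exp_pos _)]
    exact (exp_neg_lt_one (by positivity)).le
  have hlog : Real.log (1 - z) = -t₀ := by
    rw [hz, exp_neg_two_mul_log_goldenRatio, sub_sub_cancel, Real.log_inv]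
  have h1 := (summable_dilog hz1.le).hasSum.sub
    ((Real.hasSum_pow_div_log_of_abs_lt_one hz1).mul_left (2 * (t - t₀)))
  have h := hasSum_le (fun n => ?_) h1 (summable_dilog hw1).hasSum
  · rw [hlog] at h
    change dilog z - _ ≤ dilog (Real.exp (-(2 * t))) at h
    rw [rateFun, rateFun, ← hz]
    nlinarith
  · have hn : (0 : ℝ) < (n : ℝ) + 1 := by positivity
    have e1 : z ^ (n + 1) / ((n : ℝ) + 1) ^ 2 - 2 * (t - t₀) * (z ^ (n + 1) / ((n : ℝ) + 1)) =
        z ^ (n + 1) * (-(2 * (t - t₀)) * ((n : ℝ) + 1) + 1) / ((n : ℝ) + 1) ^ 2 := by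
      field_simp
      ring
    rw [e1]
    have h3 := mul_le_mul_of_nonneg_left
      (Real.add_one_le_exp (-(2 * (t - t₀)) * ((n : ℝ) + 1)))
      (pow_pos (Real.exp_pos (-(2 * t₀))) (n + 1)).le
    have e2 : Real.exp (-(2 * t₀)) ^ (n + 1) * Real.exp (-(2 * (t - t₀)) * ((n : ℝ) + 1)) =
        Real.exp (-(2 * t)) ^ (n + 1) := by
      rw [← Real.exp_nat_mul, ← Real.exp_nat_mul, ← Real.exp_add]
      push_cast
      ring_nf
    rw [e2] at h3
    gcongr

lemma hasDerivAt_exp_neg_two_mul (t : ℝ) :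
    HasDerivAt (fun t => Real.exp (-(2 * t))) (Real.exp (-(2 * t)) * (-2)) t := by
  have h : HasDerivAt (fun t : ℝ => -(2 * t)) (-2) t := by
    simpa using ((hasDerivAt_id t).const_mul 2).fun_neg
  exact h.exp

lemma hasDerivAt_rateFun {t : ℝ} (ht : 0 < t) :
    HasDerivAt rateFun (t + Real.log (1 - Real.exp (-(2 * t)))) t := by
  have d1 := (hasDerivAt_dilog (x := Real.exp (-(2 * t)))
    (by rw [abs_of_pos (Real.exp_pos _)]; exact exp_neg_lt_one (by positivity))
    (Real.exp_ne_zero _)).comp t (hasDerivAt_exp_neg_two_mul t)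
  refine ((((hasDerivAt_id t).pow 2).div_const 2).add (d1.div_const 2)).congr_deriv ?_
  have := Real.exp_ne_zero (-(2 * t))
  simp only [id]
  field_simp
  ring

lemma hasDerivAt_rateFun_deriv :
    HasDerivAt (fun t => t + Real.log (1 - Real.exp (-(2 * t)))) (Real.sqrt 5)
      (Real.log Real.goldenRatio) := by
  have hx := inv_pos.2 Real.goldenRatio_pos
  have hne : 1 - Real.exp (-(2 * Real.log Real.goldenRatio)) ≠ 0 := by
    rw [exp_neg_two_mul_log_goldenRatio, sub_sub_cancel]; exact hx.ne'
  have d := (hasDerivAt_id (Real.log Real.goldenRatio)).add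
    (((hasDerivAt_exp_neg_two_mul (Real.log Real.goldenRatio)).const_sub 1).log hne)
  refine d.congr_deriv ?_
  simp only [exp_neg_two_mul_log_goldenRatio, sub_sub_cancel]
  have h0 := Real.goldenRatio_ne_zero
  have h5 : Real.sqrt 5 = 2 * Real.goldenRatio - 1 := by rw [Real.goldenRatio]; ring
  rw [h5]
  generalize Real.goldenRatio = g at h0
  field_simp
  ring

/-- L'Hôpital reduces the quotient to half the slope of f' at a, so no second derivative away from a
is needed. -/
lemma isLittleO_sub_quadratic {f f' : ℝ → ℝ} {a c : ℝ}
    (hf : ∀ᶠ t in 𝓝 a, HasDerivAt f (f' t) t) (h0 : f' a = 0) (hf' : HasDerivAt f' c a) :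
    (fun t => f t - f a - c / 2 * (t - a) ^ 2) =o[𝓝 a] fun t => (t - a) ^ 2 := by
  have hlim : Tendsto (fun t => (f t - f a) / (t - a) ^ 2) (𝓝[≠] a) (𝓝 (c / 2)) := by
    refine HasDerivAt.lhopital_zero_nhdsNE (f' := f') (g' := fun t => 2 * (t - a)) ?_ ?_ ?_ ?_ ?_ ?_
    · filter_upwards [hf.filter_mono nhdsWithin_le_nhds] with t ht using ht.sub_const _
    · refine Eventually.of_forall fun t => ?_
      simpa using ((hasDerivAt_id t).sub_const a).fun_pow 2
    · filter_upwards [self_mem_nhdsWithin] with t ht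
      exact mul_ne_zero two_ne_zero (sub_ne_zero.2 ht)
    · have := (hf.self_of_nhds.continuousAt.tendsto.sub_const (f a)).mono_left
        (nhdsWithin_le_nhds (s := {a}ᶜ))
      simpa using this
    · have : Continuous fun t : ℝ => (t - a) ^ 2 := by fun_prop
      have := (this.tendsto a).mono_left (nhdsWithin_le_nhds (s := {a}ᶜ))
      simpa using this
    · have := (hasDerivAt_iff_tendsto_slope.1 hf').div_const 2
      refine this.congr fun t => ?_
      rw [slope_def_field, h0, sub_zero, div_div, mul_comm]
  have h1 : (fun t => f t - f a - c / 2 * (t - a) ^ 2) =o[𝓝[≠] a] fun t => (t - a) ^ 2 := by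
    rw [isLittleO_iff_tendsto']
    · refine (by simpa using hlim.sub_const (c / 2) : Tendsto _ _ (𝓝 (0 : ℝ))).congr' ?_
      filter_upwards [self_mem_nhdsWithin] with t ht
      have : t - a ≠ 0 := sub_ne_zero.2 ht
      field_simp
    · filter_upwards [self_mem_nhdsWithin] with t ht h
      exact absurd (pow_eq_zero_iff two_ne_zero |>.1 h) (sub_ne_zero.2 ht)
  rw [← nhdsNE_sup_pure a]
  exact h1.sup (by simp [isLittleO_pure])

lemma isLittleO_rateFun :
    (fun t => rateFun t - Real.pi ^ 2 / 30 -
      Real.sqrt 5 / 2 * (t - Real.log Real.goldenRatio) ^ 2)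
      =o[𝓝 (Real.log Real.goldenRatio)] fun t => (t - Real.log Real.goldenRatio) ^ 2 := by
  rw [← rateFun_log_goldenRatio]
  refine isLittleO_sub_quadratic (f' := fun t => t + Real.log (1 - Real.exp (-(2 * t)))) ?_ ?_
    hasDerivAt_rateFun_deriv
  · filter_upwards [lt_mem_nhds log_goldenRatio_pos] with t ht using hasDerivAt_rateFun ht
  · rw [exp_neg_two_mul_log_goldenRatio, sub_sub_cancel, Real.log_inv, add_neg_cancel]

/-- The terms of the generating function, normalized to have maximum about `1`, with
`t = e (k + 1)`. -/
noncomputable def normTerm (e t : ℝ) : ℝ :=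
  Real.exp ((Real.pi ^ 2 / 30 - t ^ 2 / 2) / e + t / 2 -
    negLogPochhammer (2 * e) (Real.exp (-(2 * t))))

lemma prod_range_exp_neg_pow_succ (e : ℝ) (k : ℕ) :
    ∏ j ∈ Finset.range k, Real.exp (-e) ^ (j + 1) = Real.exp (-(e * (k * (k + 1)) / 2)) := by
  induction k with
  | zero => simp
  | succ k ih =>
    rw [Finset.prod_range_succ, ih, ← Real.exp_nat_mul, ← Real.exp_add]
    push_cast
    ring_nf

/-- The factor e^(π²/(12e)) from inversion is split as e^(π²/(20e)) e^(π²/(30e)), the second factor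
normalizing the peak. -/
lemma oddEvenTerm_exp {e : ℝ} (he : 0 < e) (k : ℕ) :
    oddEvenTerm (Real.exp (-e)) k =
      Real.sqrt (e / Real.pi) * Real.exp (Real.pi ^ 2 / (20 * e)) *
        (Real.exp (-(e / 12)) / eulerProd (2 * Real.pi ^ 2 / e)) * normTerm e (e * (k + 1)) := by
  have hpi := Real.pi_pos
  have h2 : Real.exp (-e) ^ 2 = Real.exp (-(2 * e)) := by
    rw [← Real.exp_nat_mul]; push_cast; ring_nf
  have hE : Real.exp (negLogPochhammer (2 * e) (Real.exp (-(2 * e)))) =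
      Real.sqrt (e / Real.pi) * Real.exp (Real.pi ^ 2 / (12 * e) - e / 12) /
        eulerProd (2 * Real.pi ^ 2 / e) := by
    have h := eulerProd_inversion he
    rw [eulerProd_eq_exp (by positivity : 0 < 2 * e), Real.exp_neg,
      inv_eq_iff_eq_inv] at h
    rw [h, mul_inv, mul_inv, ← Real.exp_neg, ← Real.sqrt_inv, inv_div, neg_sub]
    exact (div_eq_mul_inv _ _).symm
  have hp : ∏ j ∈ Finset.range k, (1 - Real.exp (-e) ^ (2 * (j + 1))) =
      Real.exp (negLogPochhammer (2 * e) (Real.exp (-(2 * (e * (k + 1))))) -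
        negLogPochhammer (2 * e) (Real.exp (-(2 * e)))) := by
    simp only [pow_mul, h2]
    rw [prod_one_sub_exp_pow (by positivity), exp_neg_mul_pow]
    push_cast
    rw [mul_assoc]
  rw [oddEvenTerm, Finset.prod_div_distrib, hp, prod_range_exp_neg_pow_succ, ← Real.exp_sub,
    sub_sub_eq_add_sub, normTerm, add_sub_right_comm, Real.exp_add, hE]
  have e1 : Real.exp (Real.pi ^ 2 / (20 * e)) * Real.exp (-(e / 12)) *
      Real.exp ((Real.pi ^ 2 / 30 - (e * ((k : ℝ) + 1)) ^ 2 / 2) / e + e * ((k : ℝ) + 1) / 2 -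
        negLogPochhammer (2 * e) (Real.exp (-(2 * (e * ((k : ℝ) + 1)))))) =
      Real.exp (-(e * ((k : ℝ) * ((k : ℝ) + 1)) / 2) -
        negLogPochhammer (2 * e) (Real.exp (-(2 * (e * ((k : ℝ) + 1)))))) *
      Real.exp (Real.pi ^ 2 / (12 * e) - e / 12) := by
    rw [← Real.exp_add, ← Real.exp_add, ← Real.exp_add]
    congr 1
    field_simp
    ring
  linear_combination (-Real.sqrt (e / Real.pi) / eulerProd (2 * Real.pi ^ 2 / e)) * e1

/-- A majorant uniform in e, for dominated convergence. With y = (t - t₀)/√e the exponent is at most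
t₀/2 + |y|/2 - y²/2. -/
lemma normTerm_le {e t : ℝ} (he : 0 < e) (he1 : e ≤ 1) (ht : 0 < t) :
    normTerm e t ≤ Real.exp (Real.log Real.goldenRatio / 2 + 9 / 8) *
      Real.exp (-|(t - Real.log Real.goldenRatio) / Real.sqrt e|) := by
  have hw : Real.exp (-(2 * t)) < 1 := exp_neg_lt_one (by positivity)
  have h1 := le_negLogPochhammer (by positivity : 0 < 2 * e) (Real.exp_pos (-(2 * t))).le hw
  have h2 : Real.log (1 - Real.exp (-(2 * t))) ≤ 0 :=
    Real.log_nonpos (by linarith) (by linarith [Real.exp_pos (-(2 * t))])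
  have h3 := rateFun_lower ht
  rw [rateFun_log_goldenRatio, rateFun] at h3
  set t₀ := Real.log Real.goldenRatio
  have hs : 0 < Real.sqrt e := Real.sqrt_pos.2 he
  have hs1 : Real.sqrt e ≤ 1 := Real.sqrt_le_one.2 he1
  have hsq : Real.sqrt e ^ 2 = e := Real.sq_sqrt he.le
  set y := (t - t₀) / Real.sqrt e with hy
  have hty : t - t₀ = Real.sqrt e * y := by rw [hy]; field_simp
  have hyy : (t - t₀) ^ 2 / 2 / e = |y| ^ 2 / 2 := by
    rw [hty, mul_pow, hsq, sq_abs]; field_simp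
  have h4 : Real.sqrt e * y ≤ |y| :=
    (mul_le_mul_of_nonneg_left (le_abs_self y) hs.le).trans
      (mul_le_of_le_one_left (abs_nonneg y) hs1)
  have h5 := div_le_div_of_nonneg_right h3 he.le
  rw [add_div, add_div, hyy] at h5
  have h6 : dilog (Real.exp (-(2 * t))) / 2 / e = dilog (Real.exp (-(2 * t))) / (2 * e) := by
    rw [div_div]
  rw [h6] at h5
  rw [normTerm, ← Real.exp_add, Real.exp_le_exp, sub_div]
  -- The constant 9/8 completes the square: y²/2 - 3|y|/2 + 9/8 = (|y| - 3/2)²/2.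
  nlinarith [sq_nonneg (|y| - 3 / 2)]

lemma tendsto_normTerm {ι : Type*} {l : Filter ι} {e t : ι → ℝ} {y : ℝ}
    (he0 : ∀ᶠ i in l, 0 < e i) (he : Tendsto e l (𝓝 0))
    (hy : Tendsto (fun i => (t i - Real.log Real.goldenRatio) / Real.sqrt (e i)) l (𝓝 y)) :
    Tendsto (fun i => normTerm (e i) (t i)) l (𝓝 (Real.exp (-(Real.sqrt 5 / 2) * y ^ 2))) := by
  set t₀ := Real.log Real.goldenRatio with ht₀
  have hsqrt : Tendsto (fun i => Real.sqrt (e i)) l (𝓝 0) := by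
    simpa using he.sqrt
  have hsub : Tendsto (fun i => t i - t₀) l (𝓝 0) := by
    have := hy.mul hsqrt
    rw [mul_zero] at this
    refine this.congr' ?_
    filter_upwards [he0] with i hi
    exact div_mul_cancel₀ _ (Real.sqrt_pos.2 hi).ne'
  have ht : Tendsto t l (𝓝 t₀) := by simpa using hsub.add_const t₀
  have hsq : Tendsto (fun i => (t i - t₀) ^ 2 / e i) l (𝓝 (y ^ 2)) := by
    refine (hy.pow 2).congr' ?_
    filter_upwards [he0] with i hi
    rw [div_pow, Real.sq_sqrt hi.le]
  have hF : Tendsto (fun i => (rateFun (t i) - Real.pi ^ 2 / 30) / e i) l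
      (𝓝 (Real.sqrt 5 / 2 * y ^ 2)) := by
    have h1 := (isLittleO_rateFun.comp_tendsto ht).tendsto_div_nhds_zero
    have h2 := (h1.mul hsq).add (hsq.const_mul (Real.sqrt 5 / 2))
    rw [zero_mul, zero_add] at h2
    refine h2.congr' ?_
    filter_upwards [he0] with i hi
    simp only [Function.comp_apply, ← ht₀]
    rcases eq_or_ne (t i - t₀) 0 with h0 | h0
    · have : t i = t₀ := by linarith
      simp [this, ht₀, rateFun_log_goldenRatio]
    · field_simp
      ring
  have hx : Tendsto (fun i => Real.exp (-(2 * t i))) l (𝓝 (1 - Real.goldenRatio⁻¹)) := by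
    rw [← exp_neg_two_mul_log_goldenRatio]
    exact ((ht.const_mul 2).neg).rexp
  have hx' : Tendsto (fun i => 1 - Real.exp (-(2 * t i))) l (𝓝 (Real.goldenRatio⁻¹)) := by
    simpa using hx.const_sub 1
  have hg : Real.goldenRatio⁻¹ ≠ 0 := inv_ne_zero Real.goldenRatio_ne_zero
  -- The subexponential factors cancel in the limit because log(1 - e^(-2t₀)) = -t₀.
  have hlog : Tendsto (fun i => t i / 2 + Real.log (1 - Real.exp (-(2 * t i))) / 2) l (𝓝 0) := by
    have := (ht.div_const 2).add ((hx'.log hg).div_const 2)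
    rwa [Real.log_inv, ← add_div, add_neg_cancel, zero_div] at this
  have hR : Tendsto (fun i => negLogPochhammer (2 * e i) (Real.exp (-(2 * t i))) -
      (dilog (Real.exp (-(2 * t i))) / (2 * e i) - Real.log (1 - Real.exp (-(2 * t i))) / 2))
      l (𝓝 0) := by
    have hu : Tendsto (fun i => 2 * e i / 2 *
        (Real.exp (-(2 * t i)) / (1 - Real.exp (-(2 * t i))))) l (𝓝 0) := by
      have := ((he.const_mul 2).div_const 2).mul (hx.div hx' hg)
      simpa using this
    refine tendsto_of_tendsto_of_tendsto_of_le_of_le' tendsto_const_nhds hu ?_ ?_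
    · filter_upwards [he0, ht.eventually_const_lt log_goldenRatio_pos] with i hi hti
      exact sub_nonneg.2 (le_negLogPochhammer (by positivity) (Real.exp_pos _).le
        (exp_neg_lt_one (by positivity)))
    · filter_upwards [he0, ht.eventually_const_lt log_goldenRatio_pos] with i hi hti
      have := negLogPochhammer_le (by positivity : 0 < 2 * e i) (Real.exp_pos (-(2 * t i))).le
        (exp_neg_lt_one (by positivity))
      linarith
  have h := ((hF.neg.add hlog).sub hR).rexp
  rw [add_zero, sub_zero, ← neg_mul] at h
  refine h.congr' ?_
  filter_upwards [he0] with i hi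
  rw [normTerm, rateFun]
  congr 1
  field_simp
  ring

/-! ### Riemann sums and the main theorem -/

open MeasureTheory in
/-- A sum over `ℕ` as the integral of a step function. -/
lemma integral_floor_eq_tsum {g : ℕ → ℝ} (hg : Summable g) (hg0 : ∀ n, 0 ≤ g n) :
    ∫ v : ℝ, (if 0 ≤ v then g ⌊v⌋₊ else 0) = ∑' n, g n := by
  have hunion : ⋃ n : ℕ, Set.Ico (n : ℝ) (n + 1) = Set.Ici 0 := by
    ext v
    simp only [Set.mem_iUnion, Set.mem_Ico, Set.mem_Ici]
    constructor
    · rintro ⟨n, hn, -⟩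
      exact n.cast_nonneg.trans hn
    · exact fun hv => ⟨⌊v⌋₊, Nat.floor_le hv, Nat.lt_floor_add_one v⟩
  have hm : ∀ n : ℕ, MeasurableSet (Set.Ico (n : ℝ) (n + 1)) := fun n => measurableSet_Ico
  have hfl : ∀ n : ℕ, Set.EqOn (fun v : ℝ => g ⌊v⌋₊) (fun _ => g n) (Set.Ico (n : ℝ) (n + 1)) := by
    intro n v hv
    simp only [(Nat.floor_eq_iff (n.cast_nonneg.trans hv.1)).2 hv]
  have hint : ∀ n : ℕ, ∫ v in Set.Ico (n : ℝ) (n + 1), g ⌊v⌋₊ = g n := by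
    intro n
    rw [setIntegral_congr_fun (hm n) (hfl n)]
    simp
  have hi : ∀ n : ℕ, IntegrableOn (fun v : ℝ => g ⌊v⌋₊) (Set.Ico (n : ℝ) (n + 1)) := fun n =>
    (integrableOn_congr_fun (hfl n) (hm n)).2 (integrableOn_const (by simp))
  have hU : IntegrableOn (fun v : ℝ => g ⌊v⌋₊) (⋃ n : ℕ, Set.Ico (n : ℝ) (n + 1)) := by
    refine integrableOn_iUnion_of_summable_integral_norm hi ?_
    refine hg.congr fun n => ?_
    simp only [Real.norm_of_nonneg (hg0 _), hint]
  have hd : Pairwise (Function.onFun Disjoint fun n : ℕ => Set.Ico (n : ℝ) (n + 1)) := by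
    intro m n hmn
    refine Set.disjoint_left.2 fun v hv hv' => hmn ?_
    rw [← (Nat.floor_eq_iff (m.cast_nonneg.trans hv.1)).2 hv,
      ← (Nat.floor_eq_iff (n.cast_nonneg.trans hv'.1)).2 hv']
  have h := hasSum_integral_iUnion hm hd hU
  simp only [hint, hunion] at h
  rw [h.tsum_eq, ← integral_indicator measurableSet_Ici]
  rfl

open MeasureTheory in
lemma integrable_exp_neg_abs : Integrable fun u : ℝ => Real.exp (-|u|) := by
  rw [← integrableOn_univ, ← Set.Iic_union_Ioi (a := (0 : ℝ)), integrableOn_union]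
  constructor
  · refine (integrableOn_congr_fun (fun u hu => ?_) measurableSet_Iic).2 (integrableOn_exp_Iic 0)
    simp only [abs_of_nonpos (Set.mem_Iic.1 hu), neg_neg]
  · refine (integrableOn_congr_fun (fun u hu => ?_) measurableSet_Ioi).2
      (exp_neg_integrableOn_Ioi 0 one_pos)
    simp only [abs_of_pos (Set.mem_Ioi.1 hu), neg_mul, one_mul]

lemma summable_normTerm {e : ℝ} (he : 0 < e) (r : ℕ) :
    Summable fun j : ℕ => normTerm e (e * (((4 * j + r : ℕ) : ℝ) + 1)) := by
  have h := (summable_oddEvenTerm (Real.exp_pos (-e)) (exp_neg_lt_one he)).comp_injective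
    (i := fun j : ℕ => 4 * j + r) (fun a b hab => by simp only at hab; omega)
  have hpos : 0 < Real.sqrt (e / Real.pi) * Real.exp (Real.pi ^ 2 / (20 * e)) *
        (Real.exp (-(e / 12)) / eulerProd (2 * Real.pi ^ 2 / e)) := by
    have := Real.pi_pos
    have := eulerProd_pos (s := 2 * Real.pi ^ 2 / e) (by positivity)
    positivity
  rw [← summable_mul_left_iff hpos.ne']
  refine h.congr fun j => ?_
  rw [Function.comp_apply, oddEvenTerm_exp he]

-- The sum is the integral of a step function. Centring at the peak and rescaling by 4√e turns the
-- integrand into one converging pointwise to the Gaussian.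
open MeasureTheory in
lemma tendsto_sqrt_mul_tsum_normTerm (r : ℕ) :
    Tendsto (fun e : ℝ => Real.sqrt e *
        ∑' j : ℕ, normTerm e (e * (((4 * j + r : ℕ) : ℝ) + 1))) (𝓝[>] 0)
      (𝓝 (Real.sqrt (Real.pi / (Real.sqrt 5 / 2)) / 4)) := by
  set t₀ := Real.log Real.goldenRatio with ht₀
  -- Solves 4ev = t₀ + √e u, so that the index j = ⌊v⌋ corresponds to t ≈ t₀ + √e u.
  let v : ℝ → ℝ → ℝ := fun e u => (4 * Real.sqrt e)⁻¹ * u + t₀ / (4 * e)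
  let h : ℝ → ℝ → ℝ := fun e u =>
    if 0 ≤ v e u then normTerm e (e * (((4 * ⌊v e u⌋₊ + r : ℕ) : ℝ) + 1)) else 0
  -- The rounding error is √e (4(⌊v⌋ - v) + r + 1), with 4(⌊v⌋ - v) in (-4, 0].
  have hdist : ∀ e : ℝ, 0 < e → ∀ u, 0 ≤ v e u →
      |(e * (((4 * ⌊v e u⌋₊ + r : ℕ) : ℝ) + 1) - t₀) / Real.sqrt e - u| ≤
        Real.sqrt e * (r + 5) := by
    intro e he u hv
    have hs : 0 < Real.sqrt e := Real.sqrt_pos.2 he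
    have hsq : Real.sqrt e ^ 2 = e := Real.sq_sqrt he.le
    have e1 : (e * (((4 * ⌊v e u⌋₊ + r : ℕ) : ℝ) + 1) - t₀) / Real.sqrt e - u =
        Real.sqrt e * (4 * (⌊v e u⌋₊ - v e u) + r + 1) := by
      have : v e u = (4 * Real.sqrt e)⁻¹ * u + t₀ / (4 * Real.sqrt e ^ 2) := by rw [hsq]
      push_cast
      generalize (⌊v e u⌋₊ : ℝ) = m
      rw [this]
      nth_rewrite 1 [← hsq]
      field_simp
      ring
    rw [e1, abs_mul, abs_of_pos hs]
    have h1 := Nat.floor_le hv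
    have h2 := Nat.lt_floor_add_one (v e u)
    have h3 : (0 : ℝ) ≤ r := r.cast_nonneg
    refine mul_le_mul_of_nonneg_left (abs_le.2 ⟨by linarith, by linarith⟩) hs.le
  have hint : ∀ e : ℝ, 0 < e → ∫ u, h e u = 4 * (Real.sqrt e *
      ∑' j : ℕ, normTerm e (e * (((4 * j + r : ℕ) : ℝ) + 1))) := by
    intro e he
    have hs : 0 < Real.sqrt e := Real.sqrt_pos.2 he
    have h1 := integral_floor_eq_tsum (summable_normTerm he r) fun n => (Real.exp_pos _).le
    rw [← h1]
    set G : ℝ → ℝ := fun w =>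
      if 0 ≤ w then normTerm e (e * (((4 * ⌊w⌋₊ + r : ℕ) : ℝ) + 1)) else 0 with hG
    change ∫ u, G ((4 * Real.sqrt e)⁻¹ * u + t₀ / (4 * e)) = 4 * (Real.sqrt e * ∫ w, G w)
    rw [Measure.integral_comp_mul_left (fun w => G (w + t₀ / (4 * e))), integral_add_right_eq_self G,
      inv_inv, abs_of_pos (by positivity), smul_eq_mul, mul_assoc]
  have hlim : Tendsto (fun e : ℝ => ∫ u, h e u) (𝓝[>] 0)
      (𝓝 (∫ u : ℝ, Real.exp (-(Real.sqrt 5 / 2) * u ^ 2))) := by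
    have hsmall : ∀ᶠ e : ℝ in 𝓝[>] 0, 0 < e ∧ e ≤ 1 := by
      filter_upwards [Ioc_mem_nhdsGT one_pos] with e he using he
    refine tendsto_integral_filter_of_dominated_convergence
      (fun u => Real.exp (t₀ / 2 + 9 / 8) * (Real.exp (r + 5) * Real.exp (-|u|))) ?_ ?_ ?_ ?_
    · refine Eventually.of_forall fun e => Measurable.aestronglyMeasurable ?_
      have hv : Measurable (v e) := by fun_prop
      refine Measurable.ite (measurableSet_le measurable_const hv) ?_ measurable_const
      exact (measurable_from_nat (f := fun n : ℕ =>
        normTerm e (e * (((4 * n + r : ℕ) : ℝ) + 1)))).comp (Nat.measurable_floor.comp hv)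
    · filter_upwards [hsmall] with e he
      refine Eventually.of_forall fun u => ?_
      simp only [h]
      split_ifs with hv
      · rw [Real.norm_of_nonneg (show 0 ≤ normTerm e _ from (Real.exp_pos _).le)]
        have hb := normTerm_le he.1 he.2
          (t := e * (((4 * ⌊v e u⌋₊ + r : ℕ) : ℝ) + 1)) (mul_pos he.1 (by positivity))
        refine hb.trans (mul_le_mul_of_nonneg_left ?_ (Real.exp_pos _).le)
        rw [← Real.exp_add, Real.exp_le_exp]
        have h1 := hdist e he.1 u hv
        have h2 : Real.sqrt e * ((r : ℝ) + 5) ≤ r + 5 :=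
          mul_le_of_le_one_left (by positivity) (Real.sqrt_le_one.2 he.2)
        have h3 := abs_sub_abs_le_abs_sub u
          ((e * (((4 * ⌊v e u⌋₊ + r : ℕ) : ℝ) + 1) - t₀) / Real.sqrt e)
        rw [abs_sub_comm] at h3
        linarith
      · rw [norm_zero]; positivity
    · exact (integrable_exp_neg_abs.const_mul _).const_mul _
    · refine Eventually.of_forall fun u => ?_
      have he0 : Tendsto (fun e : ℝ => e) (𝓝[>] 0) (𝓝 0) :=
    tendsto_nhdsWithin_of_tendsto_nhds tendsto_id
      have hs0 : Tendsto (fun e : ℝ => Real.sqrt e) (𝓝[>] 0) (𝓝 0) := by simpa using he0.sqrt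
      -- Since t₀ > 0, the peak moves off to infinite index, so each fixed u eventually lies in the
      -- range of summation.
      have hvpos : ∀ᶠ e : ℝ in 𝓝[>] 0, 0 ≤ v e u := by
        have hc : Tendsto (fun e : ℝ => Real.sqrt e * u + t₀) (𝓝[>] 0) (𝓝 t₀) := by
          simpa using (hs0.mul_const u).add_const t₀
        filter_upwards [hc.eventually_const_lt log_goldenRatio_pos, hsmall] with e h1 h2
        have hs : 0 < Real.sqrt e := Real.sqrt_pos.2 h2.1
        have hsq : Real.sqrt e ^ 2 = e := Real.sq_sqrt h2.1.le
        have : v e u = (Real.sqrt e * u + t₀) / (4 * e) := by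
          simp only [v]
          rw [← hsq]
          simp only [Real.sqrt_sq hs.le]
          field_simp
        rw [this]
        exact div_nonneg h1.le (by linarith [h2.1])
      have hy : Tendsto (fun e : ℝ =>
          (e * (((4 * ⌊v e u⌋₊ + r : ℕ) : ℝ) + 1) - t₀) / Real.sqrt e) (𝓝[>] 0) (𝓝 u) := by
        rw [tendsto_iff_dist_tendsto_zero]
        have hb : Tendsto (fun e : ℝ => Real.sqrt e * ((r : ℝ) + 5)) (𝓝[>] 0) (𝓝 0) := by
          simpa using hs0.mul_const ((r : ℝ) + 5)
        refine squeeze_zero' (Eventually.of_forall fun _ => dist_nonneg) ?_ hb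
        filter_upwards [hvpos, hsmall] with e h1 h2 using hdist e h2.1 u h1
      refine (tendsto_normTerm (hsmall.mono fun _ h => h.1) he0 hy).congr' ?_
      filter_upwards [hvpos] with e h1
      exact (if_pos h1).symm
  rw [integral_gaussian] at hlim
  refine (hlim.div_const 4).congr' ?_
  filter_upwards [self_mem_nhdsWithin] with e he
  rw [hint e he, mul_div_cancel_left₀ _ four_ne_zero]

/-- The limit does not depend on r: √(2π/√5)/4 from the Riemann sum, times 1/√π from inversion, is
half the constant of the theorem. -/
lemma tendsto_tsum_oddEvenTerm (r : ℕ) :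
    Tendsto (fun e : ℝ => (∑' j, oddEvenTerm (Real.exp (-e)) (4 * j + r)) /
        Real.exp (Real.pi ^ 2 / (20 * e))) (𝓝[>] 0)
      (𝓝 (1 / Real.sqrt (2 * Real.sqrt 5) / 2)) := by
  have hpi := Real.pi_pos
  have he0 : Tendsto (fun e : ℝ => e) (𝓝[>] 0) (𝓝 0) :=
    tendsto_nhdsWithin_of_tendsto_nhds tendsto_id
  have h1 : Tendsto (fun e : ℝ => Real.exp (-(e / 12))) (𝓝[>] 0) (𝓝 1) := by
    simpa using ((he0.div_const 12).neg).rexp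
  have h2 : Tendsto (fun e : ℝ => eulerProd (2 * Real.pi ^ 2 / e)) (𝓝[>] 0) (𝓝 1) := by
    have ht : Tendsto (fun e : ℝ => 2 * Real.pi ^ 2 * e⁻¹) (𝓝[>] 0) atTop :=
      tendsto_inv_nhdsGT_zero.const_mul_atTop (by positivity)
    simpa only [div_eq_mul_inv, Function.comp_def] using tendsto_eulerProd_atTop.comp ht
  have h3 : Tendsto (fun e : ℝ => Real.exp (-(e / 12)) / eulerProd (2 * Real.pi ^ 2 / e)) (𝓝[>] 0)
      (𝓝 (1 / 1)) := h1.div h2 one_ne_zero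
  have h := (h3.mul (tendsto_sqrt_mul_tsum_normTerm r)).mul_const
    (Real.sqrt Real.pi)⁻¹
  have hc : 1 / 1 * (Real.sqrt (Real.pi / (Real.sqrt 5 / 2)) / 4) * (Real.sqrt Real.pi)⁻¹ =
      1 / Real.sqrt (2 * Real.sqrt 5) / 2 := by
    have h5 : 0 < Real.sqrt 5 := by positivity
    have e1 : Real.pi / (Real.sqrt 5 / 2) = 2 ^ 2 * (Real.pi / (2 * Real.sqrt 5)) := by
      field_simp
    have := Real.sqrt_pos.2 hpi
    have h6 : 0 < Real.sqrt (2 * Real.sqrt 5) := by positivity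
    rw [e1, Real.sqrt_mul (by positivity), Real.sqrt_sq (by norm_num), Real.sqrt_div hpi.le]
    field_simp
    norm_num
  rw [hc] at h
  refine h.congr' ?_
  filter_upwards [self_mem_nhdsWithin] with e he
  have he : 0 < e := he
  simp only [oddEvenTerm_exp he, tsum_mul_left]
  rw [Real.sqrt_div he.le]
  have := Real.exp_pos (Real.pi ^ 2 / (20 * e))
  field_simp

lemma isEquivalent_of_tendsto_div_exp {f : ℝ → ℝ}
    (hf : Tendsto (fun e : ℝ => f e / Real.exp (Real.pi ^ 2 / (20 * e))) (𝓝[>] 0)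
      (𝓝 (1 / Real.sqrt (2 * Real.sqrt 5)))) :
    f ~[𝓝[>] (0 : ℝ)]
      (fun ε : ℝ => 1 / Real.sqrt (2 * Real.sqrt 5) * Real.exp (Real.pi ^ 2 / (20 * ε))) := by
  have hc : 0 < 1 / Real.sqrt (2 * Real.sqrt 5) := by positivity
  refine isEquivalent_of_tendsto_one ?_
  have := hf.div_const (1 / Real.sqrt (2 * Real.sqrt 5))
  rw [div_self hc.ne'] at this
  refine this.congr fun e => ?_
  rw [Pi.div_apply, div_div, mul_comm]

theorem theorem3 :
    (∀ ε : ℝ, 0 < ε →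
      Summable (fun n : ℕ => (oddEvenCount (2 * n) : ℝ) * Real.exp (-ε) ^ (2 * n)) ∧
      Summable (fun n : ℕ => (oddEvenCount (2 * n + 1) : ℝ) * Real.exp (-ε) ^ (2 * n + 1))) ∧
    (fun ε : ℝ => oddEvenGenEven (Real.exp (-ε))) ~[𝓝[>] (0 : ℝ)]
      (fun ε : ℝ => oddEvenGenOdd (Real.exp (-ε))) ∧
    (fun ε : ℝ => oddEvenGenOdd (Real.exp (-ε))) ~[𝓝[>] (0 : ℝ)]
      (fun ε : ℝ => 1 / Real.sqrt (2 * Real.sqrt 5) * Real.exp (Real.pi ^ 2 / (20 * ε))) := by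
  have hE : (fun ε : ℝ => oddEvenGenEven (Real.exp (-ε))) ~[𝓝[>] (0 : ℝ)]
      (fun ε : ℝ => 1 / Real.sqrt (2 * Real.sqrt 5) * Real.exp (Real.pi ^ 2 / (20 * ε))) := by
    refine isEquivalent_of_tendsto_div_exp ?_
    have h := (tendsto_tsum_oddEvenTerm 0).add (tendsto_tsum_oddEvenTerm 3)
    rw [add_halves] at h
    refine h.congr' ?_
    filter_upwards [self_mem_nhdsWithin] with e he
    rw [oddEvenGenEven, (hasSum_oddEvenCount_even (Real.exp_pos _) (exp_neg_lt_one he)).tsum_eq,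
      add_div]
    simp only [add_zero]
  have hO : (fun ε : ℝ => oddEvenGenOdd (Real.exp (-ε))) ~[𝓝[>] (0 : ℝ)]
      (fun ε : ℝ => 1 / Real.sqrt (2 * Real.sqrt 5) * Real.exp (Real.pi ^ 2 / (20 * ε))) := by
    refine isEquivalent_of_tendsto_div_exp ?_
    have h := (tendsto_tsum_oddEvenTerm 1).add (tendsto_tsum_oddEvenTerm 2)
    rw [add_halves] at h
    refine h.congr' ?_
    filter_upwards [self_mem_nhdsWithin] with e he
    rw [oddEvenGenOdd, (hasSum_oddEvenCount_odd (Real.exp_pos _) (exp_neg_lt_one he)).tsum_eq,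
      add_div]
  refine ⟨fun ε hε => ⟨?_, ?_⟩, hE.trans hO.symm, hO⟩
  · exact (hasSum_oddEvenCount_even (Real.exp_pos _) (exp_neg_lt_one hε)).summable
  · exact (hasSum_oddEvenCount_odd (Real.exp_pos _) (exp_neg_lt_one hε)).summable
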